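/- Let $d\ge 0$ and let $\mathbf N$ be the space of locally finite simple counting measures on $\mathbb R^d$ (identified with their sets of atoms), with the $\sigma$-field generated by $\varphi\mapsto\varphi(B)$, $B$ Borel, and the shifts $(\theta_t\varphi)(B)=\varphi(B+t)$. Let $(\Omega,\mathcal A,\mathbb P)$ be a probability space on which $(\mathbb R^d,+)$ acts by measurable maps $\theta_t$. A \emph{stationary point process} is a pair $(\Phi,\mathbb P)$ where $\Phi:\Omega\to\mathbf N$ is measurable, $\mathbb P\circ\theta_t^{-1}=\mathbb P$ and $\Phi(\theta_t\omega)=\theta_t\Phi(\omega)$ for all $t\in\mathbb R^d$, $\omega\in\Omega$. It is \emph{ergodic} if $\mathbb P(\Phi\in A)\in\{0,1\}$ for all measurable $A\subset\mathbf N$ with $\theta_t^{-1}A=A$ for all $t$. Let $\mathbf N^0=\{\varphi\in\mathbf N: 0\in\varphi\}$, let $f:\mathbf N^0\to\mathbb R^d$ be measurable with $f(\varphi)\in\varphi$ for all $\varphi$ (a point-map), and let $F_\varphi(x)=f(\theta_x\varphi)+x$, $x\in\varphi$, be the associated flow-adapted point-shift. If $S\subset\varphi$ and $F_\varphi(S)\subset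 S$, let $G^F(S)$ be the graph with vertex set $S$ and edges $(x,F_\varphi(x))$, $x\in S$. Two vertices $x,y$ are in the same connected component of $G^F(S)$ iff $F_\varphi^m(x)=F_\varphi^n(y)$ for some $m,n\ge 0$, and in the same foil iff $F_\varphi^n(x)=F_\varphi^n(y)$ for some $n\ge 0$. A component $C$ is of class $\mathcal F/\mathcal F$ if it is finite, of class $\mathcal I/\mathcal F$ if it is infinite and all its foils are finite, and of class $\mathcal I/\mathcal I$ if it is infinite and all its foils are infinite. \textbf{Corollary.} Let $(\Phi,\mathbb P)$ be a stationary point process of finite intensity, $\mathbb E\,\Phi([0,1)^d)<\infty$, and let $F$ be the point-shift of a point-map. Then there are three stationary point processes $(\Phi_{\mathcal F/\mathcal F},\mathbb P)$, $(\Phi_{\mathcal I/\mathcal F},\mathbb P)$, $(\Phi_{\mathcal I/\mathcal I},\mathbb P)$ (each possibly empty with positive probability), defined on the same probability space with the same flow, such that: \begin{enumerate} \item for each $i\in\{\mathcal F/\mathcal F,\mathcal I/\mathcal F,\mathcal I/\mathcal I\}$, $\Phi_i$ consists exactly of the points of $\Phi$ that lie in a connected component of $G^F(\Phi)$ of class $i$;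 \item almost surely, $\Phi=\Phi_{\mathcal F/\mathcal F}+\Phi_{\mathcal I/\mathcal F}+\Phi_{\mathcal I/\mathcal I}$; \item for each $i$, $F_\Phi$ maps $\Phi_i$ into itself, and all connected components of the graph $G^F(\Phi_i)$ of the restriction of $F_\Phi$ to $\Phi_i$ are of class $i$; \item if $(\Phi,\mathbb P)$ is ergodic, then each $(\Phi_i,\mathbb P)$ is ergodic. \end{enumerate} -/

import Mathlib

open MeasureTheory Set

noncomputable section

/-- The Euclidean space `ℝ^d`. -/
abbrev Rd (d : ℕ) : Type := EuclideanSpace ℝ (Fin d)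

/-- A measure on `ℝ^d` is a locally finite simple counting measure if it is integer valued on
bounded Borel sets and gives mass at most one to each point. -/
def IsSimpleCounting {d : ℕ} (φ : Measure (Rd d)) : Prop :=
  (∀ B : Set (Rd d), MeasurableSet B → Bornology.IsBounded B → ∃ n : ℕ, φ B = n) ∧
    ∀ x : Rd d, φ {x} ≤ 1

/-- The space `𝐍` of locally finite simple counting measures on `ℝ^d`. Its (subtype) σ-field is the
one generated by the evaluations `φ ↦ φ B`, for `B` Borel. -/
abbrev CountingMeasure (d : ℕ) : Type := {φ : Measure (Rd d) // IsSimpleCounting φ}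

/-- The set of atoms of `φ`, with which `φ` is identified. -/
def CountingMeasure.supp {d : ℕ} (φ : CountingMeasure d) : Set (Rd d) :=
  {x | φ.1 {x} ≠ 0}

theorem IsSimpleCounting.map_sub {d : ℕ} {φ : Measure (Rd d)} (h : IsSimpleCounting φ)
    (t : Rd d) : IsSimpleCounting (φ.map (fun x => x - t)) := by
  have hm : Measurable (fun x : Rd d => x - t) := measurable_id.sub_const t
  refine ⟨fun B hB hb => ?_, fun x => ?_⟩
  · rw [Measure.map_apply hm hB]
    refine h.1 _ (hm hB) ?_
    have : (fun x : Rd d => x - t) ⁻¹' B = (fun x : Rd d => x + t) '' B := by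
      ext x
      constructor
      · intro hx
        exact ⟨x - t, hx, by simp⟩
      · rintro ⟨y, hy, rfl⟩
        simpa using hy
    rw [this]
    exact (isometry_add_right t).lipschitz.isBounded_image hb
  · rw [Measure.map_apply hm (measurableSet_singleton x)]
    have : (fun y : Rd d => y - t) ⁻¹' {x} = {x + t} := by
      ext y
      simp [sub_eq_iff_eq_add]
    rw [this]
    exact h.2 _

/-- The shift `θ_t` on counting measures, `(θ_t φ)(B) = φ(B + t)`; it moves an atom at `x` to
`x - t`. -/
def CountingMeasure.shift {d : ℕ} (t : Rd d) (φ : CountingMeasure d) : CountingMeasure d :=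
  ⟨φ.1.map (fun x => x - t), φ.2.map_sub t⟩

theorem CountingMeasure.mem_supp_shift {d : ℕ} (t x : Rd d) (φ : CountingMeasure d) :
    x ∈ (φ.shift t).supp ↔ x + t ∈ φ.supp := by
  have hm : Measurable (fun x : Rd d => x - t) := measurable_id.sub_const t
  have : (fun y : Rd d => y - t) ⁻¹' {x} = {x + t} := by
    ext y
    simp [sub_eq_iff_eq_add]
  simp only [CountingMeasure.supp, CountingMeasure.shift, mem_ofPred_eq]
  rw [Measure.map_apply hm (measurableSet_singleton x), this]

/-- The space `𝐍⁰` of counting measures with an atom at the origin. -/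
abbrev CountingMeasureZero (d : ℕ) : Type := {φ : CountingMeasure d // (0 : Rd d) ∈ φ.supp}

/-- A point-map: a measurable map `𝐍⁰ → ℝ^d` which selects a point of each `φ ∈ 𝐍⁰`. -/
structure PointMap (d : ℕ) where
  toFun : CountingMeasureZero d → Rd d
  measurable_toFun : Measurable toFun
  toFun_mem : ∀ φ : CountingMeasureZero d, toFun φ ∈ φ.1.supp

open Classical in
/-- The flow-adapted point-shift `F_φ(x) = f(θ_x φ) + x`, `x ∈ φ`, of a point-map `f`. The value
at points that are not in `φ` is irrelevant. -/
def PointMap.pointShift {d : ℕ} (f : PointMap d) (φ : CountingMeasure d) (x : Rd d) : Rd d :=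
  if hx : x ∈ φ.supp then
    f.toFun ⟨φ.shift x, (φ.mem_supp_shift x 0).2 (by simpa using hx)⟩ + x
  else x

/-- For a map `T` of the set `S` to itself, the foil of `x`: the points `y ∈ S` with
`T^n x = T^n y` for some `n`. -/
def foil {X : Type*} (T : X → X) (S : Set X) (x : X) : Set X :=
  {y | y ∈ S ∧ ∃ n : ℕ, T^[n] x = T^[n] y}

/-- The vertex set of the connected component of `x` in the graph on `S` with the edges
`(x, T x)`. -/
def component {X : Type*} (T : X → X) (S : Set X) (x : X) : Set X :=
  {y | y ∈ S ∧ ∃ m n : ℕ, T^[m] x = T^[n] y}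

/-- The set of all connected components of the graph on `S` with the edges `(x, T x)`. -/
def components {X : Type*} (T : X → X) (S : Set X) : Set (Set X) :=
  component T S '' S

/-- Labels for the three classes F/F, I/F and I/I. -/
inductive ComponentClass : Type
  | finFin
  | infFin
  | infInf

/-- The component `C` of the graph of `T` on `S` is of class `c`:
F/F if `C` is finite (hence so are all its foils), I/F if `C` is infinite and all its foils are
finite, I/I if `C` is infinite and all its foils are infinite. -/
def IsOfClass {X : Type*} (T : X → X) (S : Set X) : ComponentClass → Set X → Prop
  | .finFin, C => C.Finite
  | .infFin, C => C.Infinite ∧ ∀ y ∈ C, (foil T S y).Finite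
  | .infInf, C => C.Infinite ∧ ∀ y ∈ C, (foil T S y).Infinite

/-- `(Φ, P)` is a stationary point process: `Φ` is measurable, the flow `θ_t ω = t +ᵥ ω` on the
probability space preserves `P`, and `Φ (θ_t ω) = θ_t (Φ ω)`. -/
structure IsStationaryPP {d : ℕ} {Ω : Type*} [MeasurableSpace Ω] [AddAction (Rd d) Ω]
    (P : Measure Ω) (Φ : Ω → CountingMeasure d) : Prop where
  measurable : Measurable Φ
  measurePreserving : ∀ t : Rd d, MeasurePreserving (fun ω : Ω => t +ᵥ ω) P P
  flowAdapted : ∀ (t : Rd d) (ω : Ω), Φ (t +ᵥ ω) = (Φ ω).shift t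

/-- The intensity of `(Φ, P)`: the mean number of points in the unit cube `[0,1)^d`. -/
def intensity {d : ℕ} {Ω : Type*} [MeasurableSpace Ω]
    (P : Measure Ω) (Φ : Ω → CountingMeasure d) : ENNReal :=
  ∫⁻ ω, (Φ ω).1 {x : Rd d | ∀ i, x i ∈ Ico (0 : ℝ) 1} ∂P

/-- `(Φ, P)` is ergodic: every shift-invariant event of counting measures has probability `0` or `1`
under the law of `Φ`. -/
def IsErgodicPP {d : ℕ} {Ω : Type*} [MeasurableSpace Ω]
    (P : Measure Ω) (Φ : Ω → CountingMeasure d) : Prop :=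
  ∀ A : Set (CountingMeasure d), MeasurableSet A →
    (∀ t : Rd d, CountingMeasure.shift t ⁻¹' A = A) → P (Φ ⁻¹' A) = 0 ∨ P (Φ ⁻¹' A) = 1

end

/-! The set of points of a given class is determined by the configuration in a measurable,
translation-equivariant way. Restricting `φ` to it (`classPart`) therefore gives a measurable
equivariant map of the configuration space. Stationarity and ergodicity pass through such a map, and
since a class is constant on components, the restriction leaves foils and components unchanged. Only
the almost sure decomposition needs probability: an infinite component must not have both finite and
infinite foils.

Along an edge from x to F(x) the finiteness of the foil can change in two ways. An infinite foil
followed by a finite one forces an infinite fibre of F. A finite foil followed by an infinite one is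
a "last finite foil", and a component has at most one of these once fibres are finite. Both are
excluded by the mass transport principle: by stationarity, the mean mass sent from the unit cube
equals the mean mass received in it. If each point sends mass at most 1, this mean is at most the
intensity, so almost surely every point receives finite mass (`ae_forall_lintegral_lt_top`). Sending
mass 1 from x to F(x) rules out infinite fibres (`ae_finite_fibers`). Spreading mass 1 from each
point uniformly over the last finite foil of its component rules out such foils, whose points would
receive infinite mass (`foilTransport`). -/

noncomputable section

open ProbabilityTheory

namespace CountingMeasure

variable {d : ℕ}

/-! ### Counting measures as a kernel -/

/-- The tautological kernel from the space of counting measures to `ℝ^d`. -/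
def kernel (d : ℕ) : Kernel (CountingMeasure d) (Rd d) where
  toFun φ := φ.1
  measurable' := measurable_subtype_coe

/-- The annulus of points whose norm has integer part `n`. -/
def annulus (d n : ℕ) : Set (Rd d) := {x | ⌊‖x‖⌋₊ = n}

theorem measurableSet_annulus (n : ℕ) : MeasurableSet (annulus d n) :=
  (Nat.measurable_floor.comp measurable_norm) (measurableSet_singleton n)

theorem isBounded_annulus (n : ℕ) : Bornology.IsBounded (annulus d n) := by
  refine (Metric.isBounded_ball (x := (0 : Rd d)) (r := n + 1)).subset fun x hx => ?_
  rw [mem_ball_zero_iff, ← hx.out]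
  exact Nat.lt_floor_add_one _

theorem iUnion_annulus : ⋃ n, annulus d n = univ :=
  eq_univ_of_forall fun x => mem_iUnion.2 ⟨⌊‖x‖⌋₊, rfl⟩

theorem pairwise_disjoint_annulus : Pairwise (Function.onFun Disjoint (annulus d)) :=
  fun _ _ h => disjoint_left.2 fun _ hx hy => h (hx.symm.trans hy)

theorem measurableSet_annulus_eq (n k : ℕ) :
    MeasurableSet {φ : CountingMeasure d | φ.1 (annulus d n) = k} :=
  ((Measure.measurable_coe (measurableSet_annulus n)).comp measurable_subtype_coe)
    (measurableSet_singleton (k : ENNReal))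

open Classical in
/-- The restriction of the tautological kernel to the annulus `n`, on the event that the annulus
has `k` points. -/
def kernelPiece (d n k : ℕ) : Kernel (CountingMeasure d) (Rd d) :=
  Kernel.piecewise (measurableSet_annulus_eq n k)
    ((kernel d).restrict (measurableSet_annulus n)) 0

theorem kernelPiece_apply (n k : ℕ) (φ : CountingMeasure d) (B : Set (Rd d)) :
    kernelPiece d n k φ B =
      if φ.1 (annulus d n) = k then φ.1.restrict (annulus d n) B else 0 := by
  rw [kernelPiece, Kernel.piecewise_apply]
  by_cases h : φ.1 (annulus d n) = k
  · simp only [mem_ofPred_eq, h, if_true, Kernel.restrict_apply]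
    rfl
  · simp [h]

instance (n k : ℕ) : IsFiniteKernel (kernelPiece d n k) := by
  refine ⟨⟨k, ENNReal.natCast_lt_top k, fun φ => ?_⟩⟩
  rw [kernelPiece_apply]
  split_ifs with h
  · simp [h]
  · simp

/-- The mass of an annulus is finite but not bounded uniformly in `φ`; fixing its value `k` supplies
the bound. The resulting s-finiteness gives measurability of parametrized integrals and Tonelli for
`φ`. -/
theorem kernel_eq_sum :
    kernel d = Kernel.sum fun n => Kernel.sum fun k => kernelPiece d n k := by
  ext φ B hB
  rw [Kernel.sum_apply' _ _ hB]
  have h1 : ∀ n, Kernel.sum (fun k => kernelPiece d n k) φ B =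
      φ.1.restrict (annulus d n) B := by
    intro n
    obtain ⟨k, hk⟩ := φ.2.1 _ (measurableSet_annulus n) (isBounded_annulus n)
    rw [Kernel.sum_apply' _ _ hB, tsum_eq_single k]
    · rw [kernelPiece_apply, if_pos hk]
    · intro j hj
      rw [kernelPiece_apply, if_neg]
      rw [hk]
      exact_mod_cast hj.symm
  simp_rw [h1]
  rw [← Measure.sum_apply _ hB, ← Measure.restrict_iUnion pairwise_disjoint_annulus
    measurableSet_annulus, iUnion_annulus, Measure.restrict_univ]
  rfl

instance : IsSFiniteKernel (kernel d) := by
  rw [kernel_eq_sum]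
  infer_instance

instance (φ : CountingMeasure d) : SFinite φ.1 :=
  inferInstanceAs (SFinite (kernel d φ))

theorem measurable_lintegral {α : Type*} [MeasurableSpace α] {p : α → CountingMeasure d}
    (hp : Measurable p) {g : α → Rd d → ENNReal} (hg : Measurable (Function.uncurry g)) :
    Measurable fun a => ∫⁻ y, g a y ∂(p a).1 :=
  Measurable.lintegral_kernel_prod_right (κ := (kernel d).comap p hp) hg

/-- Source of the later measurability proofs: statements about the points of `φ` are rewritten as
conditions on the mass of a measurable section. -/
theorem measurable_measure {α : Type*} [MeasurableSpace α] {p : α → CountingMeasure d}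
    (hp : Measurable p) {s : Set (α × Rd d)} (hs : MeasurableSet s) :
    Measurable fun a => (p a).1 {y | (a, y) ∈ s} := by
  have h := measurable_lintegral hp (g := fun a y => s.indicator 1 (a, y))
    (measurable_one.indicator hs)
  convert h using 2 with a
  exact (lintegral_indicator_one (measurable_prodMk_left hs)).symm

theorem measurable_shift : Measurable fun q : Rd d × CountingMeasure d => q.2.shift q.1 := by
  refine Measurable.subtype_mk (Measure.measurable_of_measurable_coe _ fun B hB => ?_)
  have := measurable_measure (p := fun q : Rd d × CountingMeasure d => q.2) measurable_snd
    (s := {r | r.2 - r.1.1 ∈ B}) ((measurable_snd.sub measurable_fst.fst) hB)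
  convert this using 2 with q
  exact Measure.map_apply (measurable_id.sub_const _) hB

/-! ### Atoms -/

theorem measurableSet_mem_supp {α : Type*} [MeasurableSpace α] {p : α → CountingMeasure d}
    (hp : Measurable p) {g : α → Rd d} (hg : Measurable g) :
    MeasurableSet {a | g a ∈ (p a).supp} := by
  have := measurable_measure hp (s := {r | r.2 = g r.1})
    (measurableSet_eq_fun measurable_snd (hg.comp measurable_fst))
  exact (this (measurableSet_singleton 0)).compl

theorem one_le_of_mem_supp {φ : CountingMeasure d} {x : Rd d} (hx : x ∈ φ.supp) :
    1 ≤ φ.1 {x} := by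
  obtain ⟨n, hn⟩ := φ.2.1 {x} (measurableSet_singleton x) Bornology.isBounded_singleton
  have hx' : φ.1 {x} ≠ 0 := hx
  rw [hn] at hx' ⊢
  exact_mod_cast Nat.one_le_iff_ne_zero.2 (by exact_mod_cast hx')

/-- Every atom has mass exactly 1, so on sets of atoms `φ` counts; infinitude becomes a measurable
condition. -/
theorem measure_eq_top_iff {φ : CountingMeasure d} {A : Set (Rd d)} (hA : A ⊆ φ.supp) :
    φ.1 A = ⊤ ↔ A.Infinite := by
  refine ⟨fun h hf => ?_, fun h => h.meas_eq_top ⟨1, one_ne_zero, fun x hx =>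
    one_le_of_mem_supp (hA hx)⟩⟩
  have : φ.1 A ≤ ∑ x ∈ hf.toFinset, φ.1 {x} := by
    refine (measure_mono ?_).trans (measure_biUnion_finset_le hf.toFinset fun x => {x})
    intro x hx
    simpa using hx
  rw [h, top_le_iff, ENNReal.sum_eq_top] at this
  obtain ⟨x, -, hx⟩ := this
  have := φ.2.2 x
  rw [hx] at this
  exact absurd this (by simp)

theorem measure_eq_zero_iff {φ : CountingMeasure d} {A : Set (Rd d)} (hA : A ⊆ φ.supp) :
    φ.1 A = 0 ↔ A = ∅ := by
  refine ⟨fun h => ?_, fun h => by simp [h]⟩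
  refine eq_empty_of_forall_notMem fun x hx => hA hx ?_
  exact measure_mono_null (singleton_subset_iff.2 hx) h

/-- Around a point of mass 0 the masses of small closed balls tend to 0. Being integers, they
eventually vanish, so the complement is locally null and hence null. -/
theorem measure_compl_supp (φ : CountingMeasure d) : φ.1 φ.suppᶜ = 0 := by
  have : IsFiniteMeasureOnCompacts φ.1 := ⟨fun K hK => by
    obtain ⟨n, hn⟩ := φ.2.1 K hK.measurableSet hK.isBounded
    rw [hn]
    exact ENNReal.natCast_lt_top n⟩
  refine measure_null_of_locally_null _ fun x hx => ?_
  have hx0 : φ.1 {x} = 0 := not_not.1 hx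
  have ht := tendsto_measure_cthickening_of_isCompact (μ := φ.1) (isCompact_singleton (x := x))
  rw [hx0] at ht
  obtain ⟨r, hr, hr0⟩ := (((ht.mono_left (nhdsWithin_le_nhds (s := Ioi 0))).eventually
    (gt_mem_nhds one_pos)).and self_mem_nhdsWithin).exists
  obtain ⟨n, hn⟩ := φ.2.1 _ (Metric.isClosed_cthickening (δ := r) (E := {x})).measurableSet
    Bornology.isBounded_singleton.cthickening
  refine ⟨_, mem_nhdsWithin_of_mem_nhds (Metric.cthickening_mem_nhdsSet {x} hr0 |> fun h => by
    simpa using h), ?_⟩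
  rw [hn] at hr ⊢
  have : n < 1 := by exact_mod_cast hr
  simp [Nat.lt_one_iff.1 this]

theorem ae_mem_supp (φ : CountingMeasure d) : ∀ᵐ x ∂φ.1, x ∈ φ.supp :=
  measure_compl_supp φ

theorem shift_shift (s t : Rd d) (φ : CountingMeasure d) :
    (φ.shift t).shift s = φ.shift (s + t) := by
  refine Subtype.ext ?_
  change (φ.1.map _).map _ = φ.1.map _
  have hm : ∀ u : Rd d, Measurable fun x : Rd d => x - u := fun u => measurable_id.sub_const u
  rw [Measure.map_map (hm s) (hm t)]
  congr 1
  ext1 x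
  simp only [Function.comp]
  abel

theorem lintegral_shift (t : Rd d) (φ : CountingMeasure d) {g : Rd d → ENNReal}
    (hg : Measurable g) : ∫⁻ x, g x ∂(φ.shift t).1 = ∫⁻ x, g (x - t) ∂φ.1 :=
  lintegral_map hg (measurable_id.sub_const t)

end CountingMeasure

namespace CountingMeasure

variable {d : ℕ}

/-! ### The mass transport principle -/

/-- The half-open unit cube. -/
def unitCube (d : ℕ) : Set (Rd d) := {x | ∀ i, x i ∈ Ico (0 : ℝ) 1}

theorem measurableSet_unitCube : MeasurableSet (unitCube d) := by
  have : unitCube d = ⋂ i, (fun x : Rd d => x i) ⁻¹' Ico (0 : ℝ) 1 := by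
    ext x
    simp [unitCube]
  rw [this]
  refine MeasurableSet.iInter fun i => ?_
  exact (by fun_prop : Measurable fun x : Rd d => x i) measurableSet_Ico

/-- The indicator function of the unit cube. -/
def cubeIndicator (x : Rd d) : ENNReal := (unitCube d).indicator 1 x

theorem measurable_cubeIndicator : Measurable (cubeIndicator (d := d)) :=
  measurable_one.indicator measurableSet_unitCube

theorem cubeIndicator_of_mem {x : Rd d} (hx : x ∈ unitCube d) : cubeIndicator x = 1 :=
  indicator_of_mem hx _

theorem cubeIndicator_of_notMem {x : Rd d} (hx : x ∉ unitCube d) : cubeIndicator x = 0 :=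
  indicator_of_notMem hx _

/-- The point of the lattice `ℤ^d` in `ℝ^d` with coordinates `z`. -/
def latticePoint (z : Fin d → ℤ) : Rd d := WithLp.toLp 2 fun i => (z i : ℝ)

theorem sub_latticePoint_mem_unitCube {x : Rd d} {z : Fin d → ℤ} :
    x - latticePoint z ∈ unitCube d ↔ z = fun i => ⌊x i⌋ := by
  simp only [unitCube, latticePoint, mem_ofPred_eq, PiLp.sub_apply, mem_Ico, sub_nonneg,
    sub_lt_iff_lt_add', funext_iff, eq_comm (a := z _), Int.floor_eq_iff]

theorem tsum_cubeIndicator_sub (x : Rd d) :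
    ∑' z : Fin d → ℤ, cubeIndicator (x - latticePoint z) = 1 := by
  rw [tsum_eq_single fun i => ⌊x i⌋, cubeIndicator_of_mem (sub_latticePoint_mem_unitCube.2 rfl)]
  intro z hz
  exact cubeIndicator_of_notMem fun h => hz (sub_latticePoint_mem_unitCube.1 h)

theorem tsum_cubeIndicator_add (x : Rd d) :
    ∑' z : Fin d → ℤ, cubeIndicator (x + latticePoint z) = 1 := by
  rw [← tsum_cubeIndicator_sub x, ← (Equiv.neg (Fin d → ℤ)).tsum_eq]
  refine tsum_congr fun z => congrArg _ ?_
  rw [sub_eq_add_neg]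
  congr 1
  ext i
  simp [latticePoint]

variable {Q : Measure (CountingMeasure d)} {g : CountingMeasure d → Rd d → Rd d → ENNReal}

theorem measurable_lintegral_lintegral
    (hg : Measurable fun q : (CountingMeasure d × Rd d) × Rd d => g q.1.1 q.1.2 q.2) :
    Measurable fun φ => ∫⁻ x, ∫⁻ y, g φ x y ∂φ.1 ∂φ.1 :=
  measurable_lintegral measurable_id
    (measurable_lintegral (p := fun q : CountingMeasure d × Rd d => q.1) measurable_fst hg)

theorem tsum_lintegral_mul {ι : Type*} [Countable ι]
    (hg : Measurable fun q : (CountingMeasure d × Rd d) × Rd d => g q.1.1 q.1.2 q.2)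
    {w : ι → Rd d → Rd d → ENNReal}
    (hw : ∀ i, Measurable fun q : Rd d × Rd d => w i q.1 q.2) :
    ∑' i, ∫⁻ φ, ∫⁻ x, ∫⁻ y, w i x y * g φ x y ∂φ.1 ∂φ.1 ∂Q =
      ∫⁻ φ, ∫⁻ x, ∫⁻ y, (∑' i, w i x y) * g φ x y ∂φ.1 ∂φ.1 ∂Q := by
  have hm : ∀ i, Measurable fun q : (CountingMeasure d × Rd d) × Rd d =>
      w i q.1.2 q.2 * g q.1.1 q.1.2 q.2 := fun i =>
    ((hw i).comp (measurable_fst.snd.prodMk measurable_snd)).mul hg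
  rw [← lintegral_tsum fun i => (measurable_lintegral_lintegral
    (g := fun φ x y => w i x y * g φ x y) (hm i)).aemeasurable]
  refine lintegral_congr fun φ => ?_
  rw [← lintegral_tsum fun i => ?_]
  · refine lintegral_congr fun x => ?_
    rw [← lintegral_tsum fun i => ?_]
    · simp_rw [ENNReal.tsum_mul_right]
    · exact ((hm i).comp (measurable_prodMk_left (x := (φ, x)))).aemeasurable
  · exact ((measurable_lintegral (p := fun q : CountingMeasure d × Rd d => q.1) measurable_fst
      (g := fun q y => w i q.2 y * g q.1 q.2 y) (hm i)).comp
      (measurable_prodMk_left (x := φ))).aemeasurable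

/-- Split the transported mass by the lattice cell of the receiver. Shifting by a lattice vector
turns mass from the unit cube to one cell into mass from another cell to the unit cube; summing over
the lattice gives the total received there. -/
theorem mass_transport (hQ : ∀ t : Rd d, MeasurePreserving (shift t) Q Q)
    (hg : Measurable fun q : (CountingMeasure d × Rd d) × Rd d => g q.1.1 q.1.2 q.2)
    (hinv : ∀ t φ x y, g (shift t φ) x y = g φ (x + t) (y + t)) :
    ∫⁻ φ, ∫⁻ x, cubeIndicator x * ∫⁻ y, g φ x y ∂φ.1 ∂φ.1 ∂Q =
      ∫⁻ φ, ∫⁻ y, cubeIndicator y * ∫⁻ x, g φ x y ∂φ.1 ∂φ.1 ∂Q := by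
  have hc := measurable_cubeIndicator (d := d)
  have hgx : ∀ φ x, Measurable fun y => g φ x y := fun φ x =>
    hg.comp (measurable_prodMk_left (x := (φ, x)))
  have hgy : ∀ φ y, Measurable fun x => g φ x y := fun φ y =>
    hg.comp ((measurable_prodMk_left (x := φ)).prodMk (measurable_const (a := y)))
  have h1 : ∀ z : Fin d → ℤ,
      ∫⁻ φ, ∫⁻ x, ∫⁻ y, cubeIndicator x * cubeIndicator (y + latticePoint z) * g φ x y
        ∂φ.1 ∂φ.1 ∂Q =
      ∫⁻ φ, ∫⁻ x, ∫⁻ y, cubeIndicator (x - latticePoint z) * cubeIndicator y * g φ x y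
        ∂φ.1 ∂φ.1 ∂Q := by
    intro z
    have hm : Measurable fun q : (CountingMeasure d × Rd d) × Rd d =>
        cubeIndicator q.1.2 * cubeIndicator (q.2 + latticePoint z) * g q.1.1 q.1.2 q.2 :=
      ((hc.comp measurable_fst.snd).mul (hc.comp (measurable_snd.add_const _))).mul hg
    rw [← (hQ (latticePoint z)).lintegral_comp (measurable_lintegral_lintegral
      (g := fun φ x y => cubeIndicator x * cubeIndicator (y + latticePoint z) * g φ x y) hm)]
    refine lintegral_congr fun φ => ?_
    rw [lintegral_shift]
    · refine lintegral_congr fun x => ?_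
      rw [lintegral_shift]
      · simp only [hinv, sub_add_cancel]
      · exact hm.comp (measurable_prodMk_left 
          (x := (φ.shift (latticePoint z), x - latticePoint z)))
    · exact (measurable_lintegral (p := fun q : Rd d => φ.shift (latticePoint z))
        measurable_const (g := fun x y => cubeIndicator x *
          cubeIndicator (y + latticePoint z) * g (φ.shift (latticePoint z)) x y)
        (hm.comp (((measurable_const (a := φ.shift (latticePoint z))).prodMk measurable_fst).prodMk measurable_snd)))
  have h2 : ∫⁻ φ, ∫⁻ x, ∫⁻ y, (∑' z : Fin d → ℤ,
        cubeIndicator x * cubeIndicator (y + latticePoint z)) * g φ x y ∂φ.1 ∂φ.1 ∂Q =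
      ∫⁻ φ, ∫⁻ x, ∫⁻ y, (∑' z : Fin d → ℤ,
        cubeIndicator (x - latticePoint z) * cubeIndicator y) * g φ x y ∂φ.1 ∂φ.1 ∂Q := by
    rw [← tsum_lintegral_mul hg fun z : Fin d → ℤ => (hc.comp measurable_fst).mul
        (hc.comp (measurable_snd.add_const (latticePoint z))),
      ← tsum_lintegral_mul hg fun z : Fin d → ℤ =>
        (hc.comp (measurable_fst.sub_const (latticePoint z))).mul (hc.comp measurable_snd)]
    exact tsum_congr h1
  -- The lattice translates of the half-open cube tile the space, so each sum of indicators is 1.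
  simp only [ENNReal.tsum_mul_left, ENNReal.tsum_mul_right, tsum_cubeIndicator_add,
    tsum_cubeIndicator_sub, one_mul, mul_one] at h2
  calc _ = _ := by
        refine lintegral_congr fun φ => lintegral_congr fun x => ?_
        rw [← lintegral_const_mul _ (hgx φ x)]
    _ = _ := h2
    _ = _ := by
        refine lintegral_congr fun φ => ?_
        rw [lintegral_lintegral_swap]
        · refine lintegral_congr fun y => ?_
          rw [lintegral_const_mul _ (hgy φ y)]
        · exact ((hc.comp measurable_snd).mul (hg.comp
            (((measurable_const (a := φ)).prodMk measurable_fst).prodMk measurable_snd))).aemeasurable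

/-- If almost surely every point sends at most unit mass, then almost surely every point receives
finite mass. -/
theorem ae_forall_lintegral_lt_top (hQ : ∀ t : Rd d, MeasurePreserving (shift t) Q Q)
    (hfin : ∫⁻ φ, φ.1 (unitCube d) ∂Q ≠ ⊤)
    (hg : Measurable fun q : (CountingMeasure d × Rd d) × Rd d => g q.1.1 q.1.2 q.2)
    (hinv : ∀ t φ x y, g (shift t φ) x y = g φ (x + t) (y + t))
    (hle : ∀ᵐ φ ∂Q, ∀ x ∈ φ.supp, ∫⁻ y, g φ x y ∂φ.1 ≤ 1) :
    ∀ᵐ φ ∂Q, ∀ y ∈ φ.supp, ∫⁻ x, g φ x y ∂φ.1 < ⊤ := by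
  have hc := measurable_cubeIndicator (d := d)
  have hgy : ∀ φ y, Measurable fun x => g φ x y := fun φ y =>
    hg.comp ((measurable_prodMk_left (x := φ)).prodMk (measurable_const (a := y)))
  have hin : Measurable fun q : CountingMeasure d × Rd d =>
      cubeIndicator q.2 * ∫⁻ x, g q.1 x q.2 ∂q.1.1 :=
    (hc.comp measurable_snd).mul (measurable_lintegral measurable_fst
      (g := fun q x => g q.1 x q.2)
      (hg.comp ((measurable_fst.fst.prodMk measurable_snd).prodMk measurable_fst.snd)))
  have htot : ∫⁻ φ, ∫⁻ y, cubeIndicator y * ∫⁻ x, g φ x y ∂φ.1 ∂φ.1 ∂Q ≠ ⊤ := by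
    rw [← mass_transport hQ hg hinv]
    refine ne_top_of_le_ne_top hfin (lintegral_mono_ae ?_)
    filter_upwards [hle] with φ hφ
    rw [← lintegral_indicator_one measurableSet_unitCube]
    refine lintegral_mono_ae ?_
    filter_upwards [ae_mem_supp φ] with x hx
    exact (mul_le_mul_right (hφ x hx) _).trans_eq (mul_one _)
  have hcube : ∀ᵐ φ ∂Q, ∀ y ∈ φ.supp, y ∈ unitCube d → ∫⁻ x, g φ x y ∂φ.1 < ⊤ := by
    filter_upwards [ae_lt_top (measurable_lintegral measurable_id (g := fun φ y =>
      cubeIndicator y * ∫⁻ x, g φ x y ∂φ.1) hin) htot] with φ hφ y hy hyc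
    by_contra h
    have hae := ae_lt_top (hin.comp (measurable_prodMk_left (x := φ))) hφ.ne
    -- An atom has positive mass, so a property that holds `φ`-almost everywhere holds at every
    -- atom.
    refine hy (measure_mono_null (singleton_subset_iff.2 ?_) hae)
    simpa [cubeIndicator_of_mem hyc] using h
  -- By stationarity the statement for the unit cube holds in each of the countably many lattice
  -- cells.
  have hall : ∀ᵐ φ ∂Q, ∀ z : Fin d → ℤ, ∀ y ∈ (φ.shift (latticePoint z)).supp,
      y ∈ unitCube d → ∫⁻ x, g (φ.shift (latticePoint z)) x y
        ∂(φ.shift (latticePoint z)).1 < ⊤ :=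
    ae_all_iff.2 fun z => (hQ (latticePoint z)).quasiMeasurePreserving.ae hcube
  filter_upwards [hall] with φ hφ y hy
  have := hφ (fun i => ⌊y i⌋) (y - latticePoint fun i => ⌊y i⌋)
    ((mem_supp_shift _ _ _).2 (by simpa using hy)) (sub_latticePoint_mem_unitCube.2 rfl)
  rw [lintegral_shift _ _ (hgy _ _)] at this
  simpa [hinv] using this

end CountingMeasure

/-! ### Foils and components of a map -/

section Graph

variable {X : Type*} {T T' : X → X} {S S' : Set X} {x y z : X}

theorem self_mem_foil (hx : x ∈ S) : x ∈ foil T S x := ⟨hx, 0, rfl⟩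

theorem self_mem_component (hx : x ∈ S) : x ∈ component T S x := ⟨hx, 0, 0, rfl⟩

theorem mem_component_comm (hx : x ∈ S) (h : y ∈ component T S x) : x ∈ component T S y := by
  obtain ⟨-, m, n, h⟩ := h
  exact ⟨hx, n, m, h.symm⟩

theorem component_subset_of_iterate_eq {m n : ℕ} (h : T^[m] x = T^[n] y) :
    component T S y ⊆ component T S x := by
  rintro z ⟨hz, p, q, hpq⟩
  refine ⟨hz, p + m, n + q, ?_⟩
  rw [Function.iterate_add_apply, h, ← Function.iterate_add_apply, Nat.add_comm,
    Function.iterate_add_apply, hpq, ← Function.iterate_add_apply]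

theorem component_eq_of_mem (h : y ∈ component T S x) : component T S y = component T S x := by
  obtain ⟨-, m, n, h⟩ := h
  exact (component_subset_of_iterate_eq h).antisymm (component_subset_of_iterate_eq h.symm)

theorem foil_subset_of_iterate_eq {n : ℕ} (h : T^[n] x = T^[n] y) :
    foil T S y ⊆ foil T S x := by
  rintro z ⟨hz, p, hp⟩
  refine ⟨hz, p + n, ?_⟩
  rw [Function.iterate_add_apply, h, ← Function.iterate_add_apply, Nat.add_comm,
    Function.iterate_add_apply, hp, ← Function.iterate_add_apply]

theorem foil_eq_of_iterate_eq {n : ℕ} (h : T^[n] x = T^[n] y) : foil T S x = foil T S y :=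
  (foil_subset_of_iterate_eq h.symm).antisymm (foil_subset_of_iterate_eq h)

theorem foil_apply_subset_component : foil T S (T x) ⊆ component T S x := by
  rintro y ⟨hy, n, h⟩
  exact ⟨hy, n + 1, n, h⟩

theorem foil_subset_preimage_foil (hT : MapsTo T S S) :
    foil T S x ⊆ S ∩ T ⁻¹' foil T S (T x) := by
  rintro y ⟨hy, n, h⟩
  refine ⟨hy, hT hy, n, ?_⟩
  change T^[n + 1] x = T^[n + 1] y
  rw [Function.iterate_succ_apply', Function.iterate_succ_apply', h]

/-- The foil of `x` lies in the union of the fibres over the foil of `T x`. -/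
theorem foil_finite_of_finite_fibers (hT : MapsTo T S S)
    (hfib : ∀ y ∈ S, {x | x ∈ S ∧ T x = y}.Finite) (h : (foil T S (T x)).Finite) :
    (foil T S x).Finite := by
  refine (h.biUnion (t := fun y => {x | x ∈ S ∧ T x = y}) fun y hy => hfib y hy.1).subset ?_
  intro y hy
  have := foil_subset_preimage_foil hT hy
  exact mem_biUnion this.2 ⟨this.1, rfl⟩

theorem foil_finite_of_iterate (hT : MapsTo T S S)
    (hback : ∀ y ∈ S, (foil T S (T y)).Finite → (foil T S y).Finite) (hx : x ∈ S) (n : ℕ)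
    (h : (foil T S (T^[n] x)).Finite) : (foil T S x).Finite := by
  induction n with
  | zero => exact h
  | succ n ih =>
    rw [Function.iterate_succ_apply'] at h
    exact ih (hback _ (hT.iterate n hx) h)

/-- The last finite foil of a component: the points in a finite foil which is mapped to an
infinite foil. -/
def lastFiniteFoil (T : X → X) (S : Set X) : Set X :=
  {y | (foil T S y).Finite ∧ (foil T S (T y)).Infinite}

/-- If `m < n`, then `x` shares its finite foil with a forward iterate of `T y`. Finiteness
propagates backwards along the orbit, so the foil of `T y` would be finite. -/
theorem not_lt_of_mem_lastFiniteFoil (hT : MapsTo T S S)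
    (hback : ∀ y ∈ S, (foil T S (T y)).Finite → (foil T S y).Finite) (hyS : y ∈ S)
    (hx : x ∈ lastFiniteFoil T S) (hy : y ∈ lastFiniteFoil T S) {m n : ℕ}
    (h : T^[m] x = T^[n] y) : ¬ m < n := by
  intro hmn
  obtain ⟨k, rfl⟩ := Nat.exists_eq_add_of_lt hmn
  have h' : T^[m] x = T^[m] (T^[k] (T y)) := by
    rw [h, ← Function.iterate_succ_apply, ← Function.iterate_add_apply]
    rfl
  have := hx.1
  rw [foil_eq_of_iterate_eq h'] at this
  exact hy.2 (foil_finite_of_iterate hT hback (hT hyS) k this)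

theorem foil_eq_of_mem_lastFiniteFoil (hT : MapsTo T S S)
    (hback : ∀ y ∈ S, (foil T S (T y)).Finite → (foil T S y).Finite)
    (hx : x ∈ component T S z) (hy : y ∈ component T S z)
    (hx' : x ∈ lastFiniteFoil T S) (hy' : y ∈ lastFiniteFoil T S) :
    foil T S x = foil T S y := by
  rw [← component_eq_of_mem hx] at hy
  obtain ⟨hyS, m, n, h⟩ := hy
  have h1 := not_lt_of_mem_lastFiniteFoil hT hback hyS hx' hy' h
  have h2 := not_lt_of_mem_lastFiniteFoil hT hback hx.1 hy' hx' h.symm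
  obtain rfl : m = n := by omega
  exact foil_eq_of_iterate_eq h

theorem foil_finite_iff_of_mem_component (hT : MapsTo T S S)
    (hstep : ∀ y ∈ S, (foil T S (T y)).Finite ↔ (foil T S y).Finite) (hx : x ∈ S)
    (hy : y ∈ component T S x) : (foil T S y).Finite ↔ (foil T S x).Finite := by
  have key : ∀ z ∈ S, ∀ n : ℕ, (foil T S (T^[n] z)).Finite ↔ (foil T S z).Finite := by
    intro z hz n
    induction n with
    | zero => rfl
    | succ n ih => rw [Function.iterate_succ_apply', hstep _ (hT.iterate n hz), ih]
  obtain ⟨hyS, m, n, h⟩ := hy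
  rw [← key x hx m, ← key y hyS n, h]

theorem exists_isOfClass_component (hT : MapsTo T S S)
    (hstep : ∀ y ∈ S, (foil T S (T y)).Finite ↔ (foil T S y).Finite) (hx : x ∈ S) :
    ∃ c, IsOfClass T S c (component T S x) := by
  by_cases hC : (component T S x).Finite
  · exact ⟨.finFin, hC⟩
  by_cases hf : (foil T S x).Finite
  · exact ⟨.infFin, hC, fun y hy => (foil_finite_iff_of_mem_component hT hstep hx hy).2 hf⟩
  · exact ⟨.infInf, hC, fun y hy => mt (foil_finite_iff_of_mem_component hT hstep hx hy).1 hf⟩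

/-- A point of `C` is needed because the foil conditions of I/F and I/I quantify over `C`. -/
theorem IsOfClass.unique {C : Set X} (hxC : x ∈ C) {c c' : ComponentClass}
    (h : IsOfClass T S c C) (h' : IsOfClass T S c' C) : c = c' := by
  cases c <;> cases c' <;> first
    | rfl
    | exact absurd h h'.1
    | exact absurd h' h.1
    | exact absurd (h.2 x hxC) (h'.2 x hxC)
    | exact absurd (h'.2 x hxC) (h.2 x hxC)

/-! ### Restriction to the components of a class -/

/-- The points of `S` in components of class `c`. -/
def classSet (T : X → X) (S : Set X) (c : ComponentClass) : Set X :=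
  {x | x ∈ S ∧ IsOfClass T S c (component T S x)}

/-- The class depends only on the component, so `classSet` is a union of whole components. This is
why restricting to it changes neither foils nor components. -/
theorem component_subset_classSet {c : ComponentClass} (hx : x ∈ classSet T S c) :
    component T S x ⊆ classSet T S c := fun y hy => ⟨hy.1, by
  rw [component_eq_of_mem hy]
  exact hx.2⟩

theorem mapsTo_classSet (hT : MapsTo T S S) (c : ComponentClass) :
    MapsTo T (classSet T S c) (classSet T S c) := fun _ hx =>
  component_subset_classSet hx ⟨hT hx.1, 1, 0, rfl⟩

theorem component_classSet {c : ComponentClass} (hx : x ∈ classSet T S c) :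
    component T (classSet T S c) x = component T S x :=
  Subset.antisymm (fun _ hy => ⟨hy.1.1, hy.2⟩)
    fun _ hy => ⟨component_subset_classSet hx hy, hy.2⟩

theorem foil_classSet {c : ComponentClass} (hx : x ∈ classSet T S c) :
    foil T (classSet T S c) x = foil T S x :=
  Subset.antisymm (fun _ hy => ⟨hy.1.1, hy.2⟩)
    fun _ hy => ⟨component_subset_classSet hx ⟨hy.1, hy.2.choose, hy.2.choose, hy.2.choose_spec⟩,
      hy.2⟩

theorem isOfClass_of_mem_components_classSet {c : ComponentClass} {C : Set X}
    (hC : C ∈ components T (classSet T S c)) : IsOfClass T (classSet T S c) c C := by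
  obtain ⟨x, hx, rfl⟩ := hC
  rw [component_classSet hx]
  have hfoil : ∀ y ∈ component T S x, foil T (classSet T S c) y = foil T S y :=
    fun y hy => foil_classSet (component_subset_classSet hx hy)
  have h := hx.2
  cases c
  · exact h
  · exact ⟨h.1, fun y hy => by
      rw [hfoil y hy]
      exact h.2 y hy⟩
  · exact ⟨h.1, fun y hy => by
      rw [hfoil y hy]
      exact h.2 y hy⟩

/-! ### Conjugation -/

variable {e : X ≃ X}

/-- The conjugacy used later is `e = Equiv.addRight t`, with `T'` the point-shift of the
configuration shifted by `t`; this yields the flow-equivariance of all the graph notions. -/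
theorem iterate_conj (hT : ∀ x, e (T' x) = T (e x)) (n : ℕ) (x : X) :
    e (T'^[n] x) = T^[n] (e x) :=
  (show Function.Semiconj e T' T from hT).iterate_right n x

theorem foil_conj (hT : ∀ x, e (T' x) = T (e x)) (hS : S' = e ⁻¹' S) (x : X) :
    foil T' S' x = e ⁻¹' foil T S (e x) := by
  ext y
  simp only [foil, hS, mem_ofPred_eq, mem_preimage, ← iterate_conj hT, e.injective.eq_iff]

theorem component_conj (hT : ∀ x, e (T' x) = T (e x)) (hS : S' = e ⁻¹' S) (x : X) :
    component T' S' x = e ⁻¹' component T S (e x) := by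
  ext y
  simp only [component, hS, mem_ofPred_eq, mem_preimage, ← iterate_conj hT, e.injective.eq_iff]

theorem finite_preimage_equiv (e : X ≃ X) {A : Set X} : (e ⁻¹' A).Finite ↔ A.Finite :=
  ⟨fun h => h.of_preimage e.surjective, fun h => h.preimage e.injective.injOn⟩

theorem isOfClass_conj (hT : ∀ x, e (T' x) = T (e x)) (hS : S' = e ⁻¹' S) (c : ComponentClass)
    (A : Set X) : IsOfClass T' S' c (e ⁻¹' A) ↔ IsOfClass T S c A := by
  have key : ∀ p : X → Prop, (∀ y ∈ e ⁻¹' A, p (e y)) ↔ ∀ y ∈ A, p y := fun p =>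
    ⟨fun h y hy => by simpa using h (e.symm y) (by simpa using hy), fun h y hy => h _ hy⟩
  cases c <;> simp only [IsOfClass, foil_conj hT hS, Set.Infinite, finite_preimage_equiv]
  · rw [key fun y => (foil T S y).Finite]
  · rw [key fun y => ¬(foil T S y).Finite]

theorem classSet_conj (hT : ∀ x, e (T' x) = T (e x)) (hS : S' = e ⁻¹' S) (c : ComponentClass) :
    classSet T' S' c = e ⁻¹' classSet T S c := by
  ext x
  simp only [classSet, mem_ofPred_eq, mem_preimage, component_conj hT hS,
    isOfClass_conj hT hS c]
  rw [hS, mem_preimage]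

theorem lastFiniteFoil_conj (hT : ∀ x, e (T' x) = T (e x)) (hS : S' = e ⁻¹' S) :
    lastFiniteFoil T' S' = e ⁻¹' lastFiniteFoil T S := by
  ext x
  simp only [lastFiniteFoil, mem_ofPred_eq, mem_preimage, foil_conj hT hS, Set.Infinite,
    finite_preimage_equiv, hT]

end Graph

/-! ### The point-shift of a point-map -/

namespace PointMap

open CountingMeasure

variable {d : ℕ} (f : PointMap d)

theorem pointShift_mem {φ : CountingMeasure d} : MapsTo (f.pointShift φ) φ.supp φ.supp := by
  intro x hx
  rw [pointShift, dif_pos hx]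
  have h := f.toFun_mem ⟨φ.shift x, (φ.mem_supp_shift x 0).2 (by simpa using hx)⟩
  exact (mem_supp_shift _ _ _).1 h

theorem pointShift_shift (t x : Rd d) (φ : CountingMeasure d) :
    f.pointShift (φ.shift t) x + t = f.pointShift φ (x + t) := by
  by_cases hx : x + t ∈ φ.supp
  · rw [pointShift, pointShift, dif_pos hx, dif_pos ((mem_supp_shift _ _ _).2 hx), add_assoc]
    simp only [shift_shift]
  · rw [pointShift, pointShift, dif_neg hx, dif_neg (mt (mem_supp_shift _ _ _).1 hx)]

theorem supp_shift (t : Rd d) (φ : CountingMeasure d) :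
    (φ.shift t).supp = Equiv.addRight t ⁻¹' φ.supp := by
  ext x
  exact mem_supp_shift t x φ

/-- The point-map lives only on configurations with an atom at 0, so measurability is proved on the
measurable set of pairs with `x ∈ φ.supp` and glued to the identity off it. -/
theorem measurable_pointShift :
    Measurable fun q : CountingMeasure d × Rd d => f.pointShift q.1 q.2 := by
  classical
  have hs : MeasurableSet {q : CountingMeasure d × Rd d | q.2 ∈ q.1.supp} :=
    measurableSet_mem_supp measurable_fst measurable_snd
  have h0 : ∀ q : {q : CountingMeasure d × Rd d | q.2 ∈ q.1.supp},
      (0 : Rd d) ∈ (q.1.1.shift q.1.2).supp := fun q =>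
    (mem_supp_shift _ _ _).2 ((zero_add q.1.2).symm ▸ q.2)
  have h1 : Measurable fun q : {q : CountingMeasure d × Rd d | q.2 ∈ q.1.supp} =>
      f.toFun ⟨q.1.1.shift q.1.2, h0 q⟩ + q.1.2 := by
    refine (f.measurable_toFun.comp (Measurable.subtype_mk ?_)).add measurable_subtype_coe.snd
    exact measurable_shift.comp (measurable_subtype_coe.snd.prodMk measurable_subtype_coe.fst)
  have h2 : Measurable fun q : ({q : CountingMeasure d × Rd d | q.2 ∈ q.1.supp}ᶜ : Set _) =>
      q.1.2 := measurable_subtype_coe.snd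
  convert h1.dite h2 hs using 2 with q
  rw [pointShift]
  congr

theorem measurable_iterate_pointShift {α : Type*} [MeasurableSpace α]
    {p : α → CountingMeasure d} (hp : Measurable p) {g : α → Rd d} (hg : Measurable g) (n : ℕ) :
    Measurable fun a => (f.pointShift (p a))^[n] (g a) := by
  induction n with
  | zero => exact hg
  | succ n ih =>
    simp only [Function.iterate_succ_apply']
    exact f.measurable_pointShift.comp (hp.prodMk ih)

/-! ### Joint measurability of foils, components and classes -/

section

variable {α : Type*} [MeasurableSpace α] {p : α → CountingMeasure d} {g k : α → Rd d}

theorem measurableSet_mem_foil (hp : Measurable p) (hg : Measurable g) (hk : Measurable k) :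
    MeasurableSet {a | k a ∈ foil (f.pointShift (p a)) (p a).supp (g a)} := by
  refine (measurableSet_mem_supp hp hk).inter ?_
  have : {a | ∃ n : ℕ, (f.pointShift (p a))^[n] (g a) = (f.pointShift (p a))^[n] (k a)} =
      ⋃ n : ℕ, {a | (f.pointShift (p a))^[n] (g a) = (f.pointShift (p a))^[n] (k a)} := by
    ext a
    simp
  change MeasurableSet {a | ∃ n : ℕ, _}
  rw [this]
  exact MeasurableSet.iUnion fun n => measurableSet_eq_fun
    (f.measurable_iterate_pointShift hp hg n) (f.measurable_iterate_pointShift hp hk n)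

theorem measurableSet_mem_component (hp : Measurable p) (hg : Measurable g)
    (hk : Measurable k) :
    MeasurableSet {a | k a ∈ component (f.pointShift (p a)) (p a).supp (g a)} := by
  refine (measurableSet_mem_supp hp hk).inter ?_
  have : {a | ∃ m n : ℕ, (f.pointShift (p a))^[m] (g a) = (f.pointShift (p a))^[n] (k a)} =
      ⋃ m : ℕ, ⋃ n : ℕ,
        {a | (f.pointShift (p a))^[m] (g a) = (f.pointShift (p a))^[n] (k a)} := by
    ext a
    simp
  change MeasurableSet {a | ∃ m n : ℕ, _}
  rw [this]
  exact MeasurableSet.iUnion fun m => MeasurableSet.iUnion fun n => measurableSet_eq_fun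
    (f.measurable_iterate_pointShift hp hg m) (f.measurable_iterate_pointShift hp hk n)

theorem measurable_measure_foil (hp : Measurable p) (hg : Measurable g) :
    Measurable fun a => (p a).1 (foil (f.pointShift (p a)) (p a).supp (g a)) :=
  measurable_measure hp (f.measurableSet_mem_foil (hp.comp measurable_fst)
    (hg.comp measurable_fst) measurable_snd)

theorem measurableSet_foil_infinite (hp : Measurable p) (hg : Measurable g) :
    MeasurableSet {a | (foil (f.pointShift (p a)) (p a).supp (g a)).Infinite} := by
  convert f.measurable_measure_foil hp hg (measurableSet_singleton ⊤) using 1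
  ext a
  exact (measure_eq_top_iff fun y hy => hy.1).symm

theorem measurableSet_component_infinite (hp : Measurable p) (hg : Measurable g) :
    MeasurableSet {a | (component (f.pointShift (p a)) (p a).supp (g a)).Infinite} := by
  convert measurable_measure hp (f.measurableSet_mem_component (hp.comp measurable_fst)
    (hg.comp measurable_fst) measurable_snd) (measurableSet_singleton ⊤) using 1
  ext a
  exact (measure_eq_top_iff fun y hy => hy.1).symm

/-- The universal quantifier says that the set of violating atoms has mass 0. -/
theorem measurableSet_forall_component (hp : Measurable p) (hg : Measurable g)
    {B : Set (α × Rd d)} (hB : MeasurableSet B) :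
    MeasurableSet
      {a | ∀ y ∈ component (f.pointShift (p a)) (p a).supp (g a), (a, y) ∈ B} := by
  convert measurable_measure hp ((f.measurableSet_mem_component (hp.comp measurable_fst)
    (hg.comp measurable_fst) measurable_snd).inter hB.compl) (measurableSet_singleton 0) using 1
  ext a
  refine Iff.trans ?_ (measure_eq_zero_iff fun y hy => hy.1.1).symm
  simp only [mem_ofPred_eq, eq_empty_iff_forall_notMem, mem_inter_iff, mem_compl_iff, not_and,
    not_not]
  rfl

theorem measurableSet_mem_classSet (hp : Measurable p) (hg : Measurable g) (c : ComponentClass) :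
    MeasurableSet {a | g a ∈ classSet (f.pointShift (p a)) (p a).supp c} := by
  have hI := f.measurableSet_component_infinite hp hg
  have hF : MeasurableSet {q : α × Rd d |
      (foil (f.pointShift (p q.1)) (p q.1).supp q.2).Infinite} :=
    f.measurableSet_foil_infinite (hp.comp measurable_fst) measurable_snd
  refine (measurableSet_mem_supp hp hg).inter ?_
  cases c
  · have hC := hI.compl
    simp only [Set.Infinite, compl_ofPred, not_not] at hC
    exact hC
  · have hC := hI.inter (f.measurableSet_forall_component hp hg hF.compl)
    simp only [Set.Infinite, compl_ofPred, not_not, mem_ofPred_eq] at hC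
    exact hC
  · exact hI.inter (f.measurableSet_forall_component hp hg hF)

end

end PointMap

namespace PointMap

open CountingMeasure

variable {d : ℕ} (f : PointMap d)

/-! ### Almost sure classification of the components -/

theorem pointShift_conj (t : Rd d) (φ : CountingMeasure d) (x : Rd d) :
    Equiv.addRight t (f.pointShift (φ.shift t) x) = f.pointShift φ (Equiv.addRight t x) :=
  f.pointShift_shift t x φ

/-- Let each `x` send mass 1 to its image: `y` then receives the number of its preimages. -/
theorem ae_finite_fibers {Q : Measure (CountingMeasure d)}
    (hQ : ∀ t : Rd d, MeasurePreserving (shift t) Q Q)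
    (hfin : ∫⁻ φ, φ.1 (unitCube d) ∂Q ≠ ⊤) :
    ∀ᵐ φ ∂Q, ∀ y ∈ φ.supp, {x | x ∈ φ.supp ∧ f.pointShift φ x = y}.Finite := by
  have hs : MeasurableSet {q : (CountingMeasure d × Rd d) × Rd d |
      f.pointShift q.1.1 q.1.2 = q.2} :=
    measurableSet_eq_fun (f.measurable_pointShift.comp measurable_fst) measurable_snd
  have h := ae_forall_lintegral_lt_top hQ hfin (g := fun φ x y =>
    {q : (CountingMeasure d × Rd d) × Rd d | f.pointShift q.1.1 q.1.2 = q.2}.indicator 1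
      ((φ, x), y)) (measurable_one.indicator hs) (fun t φ x y => ?_)
    (Filter.Eventually.of_forall fun φ x _ => ?_)
  · filter_upwards [h] with φ hφ y hy
    by_contra hinf
    refine (hφ y hy).ne (top_le_iff.1 ?_)
    have hm : MeasurableSet {x | f.pointShift φ x = y} :=
      (f.measurable_pointShift.comp (measurable_prodMk_left (x := φ))) (measurableSet_singleton y)
    calc ⊤ = φ.1 {x | x ∈ φ.supp ∧ f.pointShift φ x = y} :=
          ((measure_eq_top_iff fun x hx => hx.1).2 hinf).symm
      _ ≤ φ.1 {x | f.pointShift φ x = y} := measure_mono fun x hx => hx.2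
      _ = ∫⁻ x, {x | f.pointShift φ x = y}.indicator 1 x ∂φ.1 :=
          (lintegral_indicator_one hm).symm
  · simp only [indicator_apply, mem_ofPred_eq, ← f.pointShift_shift t x φ, add_left_inj,
      Pi.one_apply]
  · calc _ = ∫⁻ y, ({f.pointShift φ x} : Set (Rd d)).indicator 1 y ∂φ.1 := by
          simp only [indicator_apply, mem_ofPred_eq, mem_singleton_iff, Pi.one_apply, eq_comm]
      _ = φ.1 {f.pointShift φ x} := lintegral_indicator_one (measurableSet_singleton _)
      _ ≤ 1 := φ.2.2 _

/-- The pairs of a vertex and a point of the last finite foil of its component. -/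
def lastFiniteFoilPairs : Set ((CountingMeasure d × Rd d) × Rd d) :=
  {q | q.2 ∈ component (f.pointShift q.1.1) q.1.1.supp q.1.2 ∧
    q.2 ∈ lastFiniteFoil (f.pointShift q.1.1) q.1.1.supp}

theorem measurableSet_lastFiniteFoilPairs : MeasurableSet f.lastFiniteFoilPairs := by
  refine (f.measurableSet_mem_component measurable_fst.fst measurable_fst.snd
    measurable_snd).inter (MeasurableSet.inter ?_ (f.measurableSet_foil_infinite
      measurable_fst.fst (f.measurable_pointShift.comp (measurable_fst.fst.prodMk
        measurable_snd))))
  have hC := (f.measurableSet_foil_infinite (α := (CountingMeasure d × Rd d) × Rd d)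
    measurable_fst.fst measurable_snd).compl
  simp only [Set.Infinite, compl_ofPred, not_not] at hC
  exact hC

/-- The mass transport in which each vertex distributes unit mass uniformly over the last finite
foil of its component. -/
def foilTransport (φ : CountingMeasure d) (x y : Rd d) : ENNReal :=
  f.lastFiniteFoilPairs.indicator
    (fun q => (q.1.1.1 (foil (f.pointShift q.1.1) q.1.1.supp q.2))⁻¹) ((φ, x), y)

theorem measurable_foilTransport :
    Measurable fun q : (CountingMeasure d × Rd d) × Rd d => f.foilTransport q.1.1 q.1.2 q.2 :=
  (f.measurable_measure_foil measurable_fst.fst measurable_snd).inv.indicator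
    f.measurableSet_lastFiniteFoilPairs

theorem measurableSet_foil (φ : CountingMeasure d) (x : Rd d) :
    MeasurableSet (foil (f.pointShift φ) φ.supp x) :=
  f.measurableSet_mem_foil (measurable_const (a := φ)) (measurable_const (a := x)) measurable_id

theorem measurableSet_component (φ : CountingMeasure d) (x : Rd d) :
    MeasurableSet (component (f.pointShift φ) φ.supp x) :=
  f.measurableSet_mem_component (measurable_const (a := φ)) (measurable_const (a := x))
    measurable_id

theorem foilTransport_shift (t : Rd d) (φ : CountingMeasure d) (x y : Rd d) :
    f.foilTransport (φ.shift t) x y = f.foilTransport φ (x + t) (y + t) := by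
  have hT := f.pointShift_conj t φ
  have hS := supp_shift t φ
  have hμ : (φ.shift t).1 (foil (f.pointShift (φ.shift t)) (φ.shift t).supp y) =
      φ.1 (foil (f.pointShift φ) φ.supp (y + t)) := by
    have hm : Measurable fun x : Rd d => x - t := measurable_id.sub_const t
    refine (Measure.map_apply hm (f.measurableSet_foil _ _)).trans ?_
    rw [foil_conj hT hS]
    congr 1
    ext z
    simp
  have hmem : ((φ.shift t, x), y) ∈ f.lastFiniteFoilPairs ↔
      ((φ, x + t), y + t) ∈ f.lastFiniteFoilPairs := by
    simp only [lastFiniteFoilPairs, mem_ofPred_eq, component_conj hT hS,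
      lastFiniteFoil_conj hT hS, mem_preimage, Equiv.coe_addRight]
  by_cases h : ((φ, x + t), y + t) ∈ f.lastFiniteFoilPairs
  · rw [foilTransport, foilTransport, indicator_of_mem h, indicator_of_mem (hmem.2 h)]
    exact congrArg Inv.inv hμ
  · rw [foilTransport, foilTransport, indicator_of_notMem h, indicator_of_notMem (mt hmem.1 h)]

/-- All receivers of mass from `x` lie in one foil `L`, the unique last finite foil of the
component, and each gets `1 / φ(L)`. -/
theorem lintegral_foilTransport_le {φ : CountingMeasure d}
    (hback : ∀ y ∈ φ.supp, (foil (f.pointShift φ) φ.supp (f.pointShift φ y)).Finite →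
      (foil (f.pointShift φ) φ.supp y).Finite) (x : Rd d) :
    ∫⁻ y, f.foilTransport φ x y ∂φ.1 ≤ 1 := by
  by_cases h : ∃ y, ((φ, x), y) ∈ f.lastFiniteFoilPairs
  · obtain ⟨y₀, h₀⟩ := h
    set L := foil (f.pointShift φ) φ.supp y₀ with hL
    have hle : ∀ y, f.foilTransport φ x y ≤ L.indicator (fun _ => (φ.1 L)⁻¹) y := by
      intro y
      by_cases hy : ((φ, x), y) ∈ f.lastFiniteFoilPairs
      · have heq : foil (f.pointShift φ) φ.supp y = L :=
          foil_eq_of_mem_lastFiniteFoil f.pointShift_mem hback hy.1 h₀.1 hy.2 h₀.2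
        have hyL : y ∈ L := heq ▸ self_mem_foil hy.1.1
        rw [foilTransport, indicator_of_mem hy, indicator_of_mem hyL]
        exact (congrArg (fun A => (φ.1 A)⁻¹) heq).le
      · rw [foilTransport, indicator_of_notMem hy]
        exact zero_le
    calc _ ≤ ∫⁻ y, L.indicator (fun _ => (φ.1 L)⁻¹) y ∂φ.1 := lintegral_mono hle
      _ = (φ.1 L)⁻¹ * φ.1 L := lintegral_indicator_const (f.measurableSet_foil _ _) _
      _ ≤ 1 := ENNReal.inv_mul_le_one _
  · have h0 : ∀ y, f.foilTransport φ x y = 0 := fun y =>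
      indicator_of_notMem (fun hy => h ⟨y, hy⟩) _
    simp [h0]

/-- Each point of the component of `y` sends `y` the same positive mass `1 / φ(L)`, and the
component is infinite because it contains the infinite foil of the image of `y`. -/
theorem lintegral_foilTransport_eq_top {φ : CountingMeasure d} {y : Rd d} (hy : y ∈ φ.supp)
    (hlast : y ∈ lastFiniteFoil (f.pointShift φ) φ.supp) :
    ∫⁻ x, f.foilTransport φ x y ∂φ.1 = ⊤ := by
  set L := foil (f.pointShift φ) φ.supp y with hL
  set C := component (f.pointShift φ) φ.supp y with hC
  have hCinf : φ.1 C = ⊤ := (measure_eq_top_iff fun x hx => hx.1).2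
    (hlast.2.mono foil_apply_subset_component)
  have hLfin : φ.1 L ≠ ⊤ := mt (measure_eq_top_iff fun x hx => hx.1).1 (not_not.2 hlast.1)
  refine top_le_iff.1 ?_
  calc ⊤ = (φ.1 L)⁻¹ * φ.1 C := by
        rw [hCinf, ENNReal.mul_top (ENNReal.inv_ne_zero.2 hLfin)]
    _ = ∫⁻ x, C.indicator (fun _ => (φ.1 L)⁻¹) x ∂φ.1 :=
        (lintegral_indicator_const (f.measurableSet_component _ _) _).symm
    _ ≤ _ := lintegral_mono fun x => ?_
  by_cases hx : x ∈ C
  · have hxy : ((φ, x), y) ∈ f.lastFiniteFoilPairs := ⟨mem_component_comm hy hx, hlast⟩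
    rw [indicator_of_mem hx, foilTransport, indicator_of_mem hxy]
  · rw [indicator_of_notMem hx]
    exact zero_le

theorem ae_exists_isOfClass {Q : Measure (CountingMeasure d)}
    (hQ : ∀ t : Rd d, MeasurePreserving (shift t) Q Q)
    (hfin : ∫⁻ φ, φ.1 (unitCube d) ∂Q ≠ ⊤) :
    ∀ᵐ φ ∂Q, ∀ x ∈ φ.supp, ∃ c, x ∈ classSet (f.pointShift φ) φ.supp c := by
  have hback : ∀ᵐ φ ∂Q, ∀ y ∈ φ.supp,
      (foil (f.pointShift φ) φ.supp (f.pointShift φ y)).Finite →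
        (foil (f.pointShift φ) φ.supp y).Finite := by
    filter_upwards [f.ae_finite_fibers hQ hfin] with φ hφ y _ h
    exact foil_finite_of_finite_fibers f.pointShift_mem hφ h
  have hrec := ae_forall_lintegral_lt_top hQ hfin f.measurable_foilTransport
    f.foilTransport_shift (hback.mono fun φ hφ x _ => f.lintegral_foilTransport_le hφ x)
  filter_upwards [hback, hrec] with φ hφ hφ' x hx
  have hforw : ∀ y ∈ φ.supp, (foil (f.pointShift φ) φ.supp y).Finite →
      (foil (f.pointShift φ) φ.supp (f.pointShift φ y)).Finite := by
    intro y hy h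
    by_contra hinf
    exact (hφ' y hy).ne (f.lintegral_foilTransport_eq_top hy ⟨h, hinf⟩)
  obtain ⟨c, hc⟩ := exists_isOfClass_component f.pointShift_mem
    (fun y hy => ⟨hφ y hy, hforw y hy⟩) hx
  exact ⟨c, hx, hc⟩

/-! ### The part of a counting measure in components of a given class -/

theorem measurableSet_classSet (φ : CountingMeasure d) (c : ComponentClass) :
    MeasurableSet (classSet (f.pointShift φ) φ.supp c) :=
  f.measurableSet_mem_classSet (measurable_const (a := φ)) measurable_id c

/-- The points of `φ` in components of class `c`, as a counting measure. -/
def classPart (c : ComponentClass) (φ : CountingMeasure d) : CountingMeasure d :=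
  ⟨φ.1.restrict (classSet (f.pointShift φ) φ.supp c), fun B hB hb => by
      rw [Measure.restrict_apply hB]
      exact φ.2.1 _ (hB.inter (f.measurableSet_classSet φ c)) (hb.subset inter_subset_left),
    fun x => (Measure.restrict_apply_le _ _).trans (φ.2.2 x)⟩

theorem supp_classPart (c : ComponentClass) (φ : CountingMeasure d) :
    (f.classPart c φ).supp = classSet (f.pointShift φ) φ.supp c := by
  ext x
  change φ.1.restrict _ {x} ≠ 0 ↔ _
  rw [Measure.restrict_apply (measurableSet_singleton x)]
  by_cases hx : x ∈ classSet (f.pointShift φ) φ.supp c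
  · rw [inter_eq_left.2 (singleton_subset_iff.2 hx)]
    exact iff_of_true hx.1 hx
  · rw [singleton_inter_eq_empty.2 hx, measure_empty]
    exact iff_of_false (not_not.2 rfl) hx

theorem measurable_classPart (c : ComponentClass) : Measurable (f.classPart c) := by
  refine Measurable.subtype_mk (Measure.measurable_of_measurable_coe _ fun B hB => ?_)
  convert measurable_measure (p := fun φ : CountingMeasure d => φ) measurable_id
    ((measurable_snd hB).inter (f.measurableSet_mem_classSet measurable_fst measurable_snd c))
    using 2 with φ
  exact Measure.restrict_apply hB

theorem classPart_shift (c : ComponentClass) (t : Rd d) (φ : CountingMeasure d) :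
    f.classPart c (φ.shift t) = (f.classPart c φ).shift t := by
  have hm : Measurable fun x : Rd d => x - t := measurable_id.sub_const t
  refine Subtype.ext ?_
  change (φ.1.map _).restrict _ = (φ.1.restrict _).map _
  rw [Measure.restrict_map hm (f.measurableSet_classSet _ c),
    classSet_conj (f.pointShift_conj t φ) (supp_shift t φ)]
  congr 2
  ext x
  simp

theorem sum_classPart {φ : CountingMeasure d}
    (h : ∀ x ∈ φ.supp, ∃ c, x ∈ classSet (f.pointShift φ) φ.supp c) :
    φ.1 = (f.classPart .finFin φ).1 + (f.classPart .infFin φ).1 + (f.classPart .infInf φ).1 := by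
  have hdisj : ∀ c c', c ≠ c' → Disjoint (classSet (f.pointShift φ) φ.supp c)
      (classSet (f.pointShift φ) φ.supp c') := fun c c' hne =>
    disjoint_left.2 fun x hx hx' => hne (hx.2.unique (self_mem_component hx.1) hx'.2)
  change φ.1 = φ.1.restrict _ + φ.1.restrict _ + φ.1.restrict _
  have h12 := hdisj .finFin .infFin (fun h => nomatch h)
  have h13 := hdisj .finFin .infInf (fun h => nomatch h)
  have h23 := hdisj .infFin .infInf (fun h => nomatch h)
  rw [← Measure.restrict_union h12 (f.measurableSet_classSet _ _),
    ← Measure.restrict_union (disjoint_union_left.2 ⟨h13, h23⟩) (f.measurableSet_classSet _ _)]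
  refine (Measure.restrict_eq_self_of_ae_mem ((ae_mem_supp φ).mono fun x hx => ?_)).symm
  obtain ⟨c, hc⟩ := h x hx
  cases c
  · exact .inl (.inl hc)
  · exact .inl (.inr hc)
  · exact .inr hc

end PointMap

end

/-! ### The decomposition of a stationary point process -/

theorem mainTheorem10 (d : ℕ) {Ω : Type*} [MeasurableSpace Ω] [AddAction (Rd d) Ω]
    (P : Measure Ω) [IsProbabilityMeasure P] (Φ : Ω → CountingMeasure d)
    (hΦ : IsStationaryPP P Φ) (hfin : intensity P Φ ≠ ⊤) (f : PointMap d) :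
    ∃ Ψ : ComponentClass → Ω → CountingMeasure d,
      -- the three parts are stationary point processes on the same probability space
      (∀ c, IsStationaryPP P (Ψ c)) ∧
      -- `Ψ c` consists of the points of `Φ` that lie in components of class `c`
      (∀ c ω, (Ψ c ω).supp = {x | x ∈ (Φ ω).supp ∧
        IsOfClass (f.pointShift (Φ ω)) (Φ ω).supp c
          (component (f.pointShift (Φ ω)) (Φ ω).supp x)}) ∧
      -- `Φ` is almost surely the sum of the three parts
      (∀ᵐ ω ∂P, (Φ ω).1 = (Ψ .finFin ω).1 + (Ψ .infFin ω).1 + (Ψ .infInf ω).1) ∧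
      -- the graph of the point-shift restricts to each part, with all components of its class
      (∀ c ω, MapsTo (f.pointShift (Φ ω)) (Ψ c ω).supp (Ψ c ω).supp ∧
        ∀ C ∈ components (f.pointShift (Φ ω)) (Ψ c ω).supp,
          IsOfClass (f.pointShift (Φ ω)) (Ψ c ω).supp c C) ∧
      -- ergodicity is inherited
      (IsErgodicPP P Φ → ∀ c, IsErgodicPP P (Ψ c)) := by
  refine ⟨fun c ω => f.classPart c (Φ ω), fun c => ?_, fun c ω => f.supp_classPart c (Φ ω), ?_,
    fun c ω => ?_, fun herg c A hA hinv => ?_⟩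
  · refine ⟨(f.measurable_classPart c).comp hΦ.measurable, hΦ.measurePreserving, fun t ω => ?_⟩
    simp only [hΦ.flowAdapted, f.classPart_shift]
  -- The almost sure classification is applied to the law of `Φ`, which is shift-invariant by
  -- stationarity and flow-adaptedness.
  · have hQ : ∀ t : Rd d,
        MeasurePreserving (CountingMeasure.shift t) (P.map Φ) (P.map Φ) := by
      intro t
      have hshift : Measurable (CountingMeasure.shift (d := d) t) :=
        CountingMeasure.measurable_shift.comp measurable_prodMk_left
      refine ⟨hshift, ?_⟩
      rw [Measure.map_map hshift hΦ.measurable,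
        show CountingMeasure.shift t ∘ Φ = Φ ∘ fun ω => t +ᵥ ω from
          funext fun ω => (hΦ.flowAdapted t ω).symm,
        ← Measure.map_map hΦ.measurable (hΦ.measurePreserving t).measurable,
        (hΦ.measurePreserving t).map_eq]
    have hfin' : ∫⁻ φ, φ.1 (CountingMeasure.unitCube d) ∂(P.map Φ) ≠ ⊤ := by
      have hm : Measurable fun φ : CountingMeasure d => φ.1 (CountingMeasure.unitCube d) :=
        (Measure.measurable_coe CountingMeasure.measurableSet_unitCube).comp
          measurable_subtype_coe
      rw [lintegral_map hm hΦ.measurable]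
      exact hfin
    filter_upwards [ae_of_ae_map hΦ.measurable.aemeasurable (f.ae_exists_isOfClass hQ hfin')]
      with ω hω
    exact f.sum_classPart hω
  · rw [f.supp_classPart]
    exact ⟨mapsTo_classSet f.pointShift_mem c,
      fun C hC => isOfClass_of_mem_components_classSet hC⟩
  -- The event for the part is the event that `Φ` lies in the preimage of `A` under `classPart`, and
  -- equivariance makes this preimage shift-invariant.
  · refine herg _ (f.measurable_classPart c hA) fun t => ?_
    ext φ
    simp only [mem_preimage, f.classPart_shift]
    exact Set.ext_iff.1 (hinv t) _
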